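/- Let $\hat{\mathbb Z}=\prod_p\mathbb Z_p$ be the ring of profinite integers with its Haar probability measure, let $\mathbb A_{\mathbb Z}=\mathbb R\times\hat{\mathbb Z}$ be the adelic integers with the product of Lebesgue measure and this measure, and let $\iota:\mathbb Z\to\mathbb A_{\mathbb Z}$ be the diagonal embedding. For a finite-dimensional complex normed space $B$, a Schwartz--Bruhat function $F:\mathbb A_{\mathbb Z}\to B$ is a function of the form $F(x,y)=f(x,\,y \bmod q)$ for some integer $q\ge 1$ and some $f:\mathbb R\times\mathbb Z/q\mathbb Z\to B$ that is a Schwartz function of the real variable; its Fourier transform is the function on $\mathbb R\times\mathbb Q/\mathbb Z$ $$\mathcal F F(\xi,\alpha)=\int_{\mathbb A_{\mathbb Z}}F(x,y)\,e(x\xi+y\cdot\alpha)\,d\mu(x,y),\qquad e(\theta)=e^{2\pi i\theta},\quad y\cdot\left(\tfrac{a}{q}\bmod 1\right)=\tfrac{ya \bmod q}{q},$$ and $F$ has Fourier support in $\Omega\subset\mathbb R\times\mathbb Q/\mathbb Z$ if $\mathcal F F$ vanishes almost everywhere outside $\Omega$ (for Lebesgue measure times counting measure). Write $\mathcal SF=F\circ\iota$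 for the restriction of $F$ to $\mathbb Z$. **Theorem (Quantitative Shannon sampling theorem).** For every $0<p\le\infty$ and every $0<c_0<\frac12$ there is a constant $0<C<\infty$, depending only on $p$ and $c_0$, such that for every finite-dimensional complex normed space $B$, every integer $Q\ge1$ and every $B$-valued Schwartz--Bruhat function $F$ on $\mathbb A_{\mathbb Z}$ with Fourier support in $[-\frac{c_0}{Q},\frac{c_0}{Q}]\times\frac1Q\mathbb Z/\mathbb Z$, $$\|\mathcal SF\|_{\ell^p(\mathbb Z;B)}\le C\,\|F\|_{L^p(\mathbb A_{\mathbb Z};B)}\quad\text{and}\quad \|F\|_{L^p(\mathbb A_{\mathbb Z};B)}\le C\,\|\mathcal SF\|_{\ell^p(\mathbb Z;B)}.$$ -/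

import Mathlib

open MeasureTheory
open scoped ENNReal NNReal SchwartzMap

noncomputable section

namespace Adelic

instance factPrimePrimes (p : Nat.Primes) : Fact (Nat.Prime (p : ℕ)) := ⟨p.2⟩

/-- The profinite integers `Ẑ = ∏ₚ ℤₚ`, with the product topology and product ring structure. -/
abbrev ZHat : Type := ∀ p : Nat.Primes, ℤ_[(p : ℕ)]

instance : MeasurableSpace ZHat := borel ZHat

instance : BorelSpace ZHat := ⟨rfl⟩

/-- The Haar probability measure on the compact group `Ẑ`. -/
def haarZHat : Measure ZHat := Measure.addHaarMeasure (⊤ : TopologicalSpace.PositiveCompacts ZHat)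

instance : IsProbabilityMeasure haarZHat :=
  ⟨by
    have h := Measure.addHaarMeasure_self (K₀ := (⊤ : TopologicalSpace.PositiveCompacts ZHat))
    simpa [haarZHat] using h⟩

/-- The adelic integers `𝔸_ℤ = ℝ × Ẑ`. -/
abbrev AZ : Type := ℝ × ZHat

/-- The product Haar measure on `𝔸_ℤ`. -/
def haarAZ : Measure AZ := (volume : Measure ℝ).prod haarZHat

/-- The reduction homomorphism `y ↦ y mod n` from `Ẑ` to `ℤ/nℤ`: its component at a prime `p ∣ n`
(under the Chinese remainder isomorphism) is the reduction of `yₚ` modulo the exact power of `p`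
dividing `n`. -/
def modHom (n : ℕ) [NeZero n] : ZHat →+* ZMod n :=
  ((ZMod.equivPi n (NeZero.ne n)).symm : _ →+* ZMod n).comp
    (RingHom.pi fun p : n.primeFactors =>
      haveI : Fact (Nat.Prime (p : ℕ)) := ⟨Nat.prime_of_mem_primeFactors p.2⟩
      (PadicInt.toZModPow (p := (p : ℕ)) (n.factorization p)).comp
        (Pi.evalRingHom (fun q : Nat.Primes => ℤ_[(q : ℕ)])
          ⟨(p : ℕ), Nat.prime_of_mem_primeFactors p.2⟩))

/-- The group `ℚ/ℤ` of arithmetic frequencies. -/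
abbrev QModZ : Type := AddCircle (1 : ℚ)

instance : Countable QModZ := Quotient.countable

/-- `(y a mod q)/q` as an element of `ℝ/ℤ`. -/
def pairFrac (y : ZHat) (a : ℤ) (q : ℕ) [NeZero q] : UnitAddCircle :=
  ZMod.toAddCircle (modHom q y * (a : ZMod q))

/-- For `r = a/q` in lowest terms, `(y a mod q)/q` as an element of `ℝ/ℤ`. -/
def pairRat (y : ZHat) (r : ℚ) : UnitAddCircle :=
  haveI : NeZero r.den := ⟨r.den_nz⟩
  pairFrac y r.num r.den

theorem pairRat_add_int (y : ZHat) (r : ℚ) (k : ℤ) : pairRat y (r + k) = pairRat y r := by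
  have hden : (r + k).den = r.den := Rat.add_intCast_den r k
  have hnum : (r + k).num = r.num + k * r.den := by
    have h1 : ((r + k).num : ℚ) = (r + k) * (r + k).den := (Rat.mul_den_eq_num _).symm
    have h2 : (r.num : ℚ) = r * r.den := (Rat.mul_den_eq_num _).symm
    rw [hden] at h1
    have h3 : ((r + k).num : ℚ) = ((r.num + k * r.den : ℤ) : ℚ) := by
      push_cast
      rw [h1, h2]
      ring
    exact_mod_cast h3
  have key : ∀ (d e : ℕ) [NeZero d] [NeZero e] (a b : ℤ), d = e → a = b + k * e →
      pairFrac y a d = pairFrac y b e := by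
    intro d e _ _ a b hd ha
    subst hd ha
    simp [pairFrac]
  have : NeZero r.den := ⟨r.den_nz⟩
  have : NeZero (r + k).den := ⟨(r + k).den_nz⟩
  exact key _ _ _ _ hden hnum

/-- The pairing `Ẑ × ℚ/ℤ → ℝ/ℤ`, `y · (a/q mod 1) = (y a mod q)/q`. -/
def pairZHat (y : ZHat) (α : QModZ) : UnitAddCircle :=
  Quotient.liftOn' α (pairRat y) (by
    intro r s h
    obtain ⟨k, hk⟩ := AddSubgroup.mem_zmultiples_iff.mp (QuotientAddGroup.leftRel_apply.mp h)
    have hs : s = r + (k : ℚ) := by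
      simp at hk
      linarith
    rw [hs, pairRat_add_int])

/-- The pairing of `𝔸_ℤ = ℝ × Ẑ` with its dual `ℝ × ℚ/ℤ`. -/
def pairAZ (z : AZ) (ζ : ℝ × QModZ) : UnitAddCircle :=
  ((z.1 * ζ.1 : ℝ) : UnitAddCircle) + pairZHat z.2 ζ.2

section Functions

variable {B : Type*} [NormedAddCommGroup B] [NormedSpace ℂ B]

/-- Schwartz–Bruhat functions `𝔸_ℤ → B`: those of the form `(x, y) ↦ f (x, y mod q)` with `q ≥ 1`
and `f : ℝ × ℤ/qℤ → B` Schwartz in the real variable. -/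
def IsSchwartzBruhat (F : AZ → B) : Prop :=
  ∃ (q : ℕ) (_ : NeZero q) (f : ZMod q → 𝓢(ℝ, B)),
    ∀ (x : ℝ) (y : ZHat), F (x, y) = f (modHom q y) x

/-- The Fourier transform `∫ F(z) e(z · ζ) dz` on `𝔸_ℤ`, where `e(θ) = exp(2πiθ)`. -/
def fourierAZ (F : AZ → B) (ζ : ℝ × QModZ) : B :=
  ∫ z : AZ, (AddCircle.toCircle (pairAZ z ζ) : ℂ) • F z ∂haarAZ

/-- `F` is Fourier supported in `Ω`: its Fourier transform vanishes outside `Ω`, modulo null sets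
of the product of Lebesgue measure on `ℝ` and counting measure on `ℚ/ℤ`. -/
def FourierSupportedIn (F : AZ → B) (Ω : Set (ℝ × QModZ)) : Prop :=
  ∀ᵐ ζ ∂((volume : Measure ℝ).prod (Measure.count : Measure QModZ)), ζ ∉ Ω → fourierAZ F ζ = 0

end Functions

/-- The subgroup `(1/Q)ℤ/ℤ` of `ℚ/ℤ`, as a set. -/
def fracSubgroup (Q : ℕ) : Set QModZ := {α | ∃ a : ℤ, α = (((a : ℚ) / (Q : ℚ) : ℚ) : QModZ)}

/-- The inclusion `ι : ℤ → 𝔸_ℤ`, the diagonal embedding. -/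
def iota (n : ℤ) : AZ := ((n : ℝ), (n : ZHat))

/-- The sampling operator `𝒮 F = F ∘ ι`. -/
def sampling {B : Type*} (F : AZ → B) : ℤ → B := fun n => F (iota n)

end Adelic

end

open scoped FourierTransform ContDiff

theorem Real.integral_fourier_smul_eq_of_integrable {E : Type*} [NormedAddCommGroup E]
    [NormedSpace ℂ E] [CompleteSpace E] {f : ℝ → ℂ} {g : ℝ → E} (hf : Integrable f)
    (hg : Integrable g) : ∫ ξ, 𝓕 f ξ • g ξ = ∫ x, f x • 𝓕 g x := by
  simpa using! (VectorFourier.integral_fourierIntegral_smul_eq_flip (L := innerₗ ℝ)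
    Real.continuous_fourierChar continuous_inner hf hg)

theorem Real.fourier_fourierChar_mul (f : ℝ → ℂ) (a w : ℝ) :
    𝓕 (fun u : ℝ => (𝐞 (-(u * a)) : ℂ) * f u) w = 𝓕 f (w + a) := by
  rw [Real.fourier_real_eq, Real.fourier_real_eq]
  congr 1 with u
  simp only [Circle.smul_def, smul_eq_mul, ← mul_assoc, ← Circle.coe_mul, ← AddChar.map_add_eq_mul]
  congr 3
  ring

theorem Real.fourier_fourierChar_mul_sub (f : ℝ → ℂ) (x u : ℝ) :
    𝓕 (fun ξ : ℝ => (𝐞 (ξ * x) : ℂ) * f ξ) u = 𝓕⁻ f (x - u) := by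
  rw [Real.fourier_real_eq, Real.fourierInv_eq']
  congr 1 with ξ
  simp only [Circle.smul_def, smul_eq_mul, ← mul_assoc, ← Circle.coe_mul, ← AddChar.map_add_eq_mul]
  congr 1
  rw [Real.fourierChar_apply]
  simp
  ring_nf

theorem MeasureTheory.Integrable.fourierChar_mul {f : ℝ → ℂ} (hf : Integrable f) {a : ℝ → ℝ}
    (ha : Continuous a) : Integrable (fun u : ℝ => (𝐞 (a u) : ℂ) * f u) := by
  refine hf.bdd_mul (c := 1) ?_ ?_
  · have := Real.continuous_fourierChar
    exact Continuous.aestronglyMeasurable (by fun_prop)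
  · exact Filter.Eventually.of_forall fun u => (Circle.norm_coe _).le

/-- The Fourier transform of the product of `H` with a translated reflected kernel. -/
theorem SchwartzMap.fourier_mul_fourierInv_sub (ψ H : 𝓢(ℝ, ℂ)) (x k : ℝ) :
    𝓕 (fun u : ℝ => 𝓕⁻ ψ (x - u) * H u) k = ∫ ξ, 𝐞 (ξ * x) * ψ ξ * 𝓕 H (ξ + k) := by
  have h := Real.integral_fourier_smul_eq_of_integrable
    (f := fun ξ : ℝ => (𝐞 (ξ * x) : ℂ) * ψ ξ) (g := fun u : ℝ => (𝐞 (-(u * k)) : ℂ) * H u)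
    (ψ.integrable.fourierChar_mul (by fun_prop)) (H.integrable.fourierChar_mul (by fun_prop))
  simp only [Real.fourier_fourierChar_mul, Real.fourier_fourierChar_mul_sub, smul_eq_mul] at h
  rw [SchwartzMap.fourier_coe, ← h, Real.fourier_real_eq, SchwartzMap.fourierInv_coe]
  congr 1 with u
  simp only [Circle.smul_def, smul_eq_mul]
  ring

/-- Sampling formula for a band-limited Schwartz function, with a rapidly decaying kernel. -/
theorem SchwartzMap.eq_tsum_mul_fourierInv {c : ℝ} {ψ : 𝓢(ℝ, ℂ)}
    (hψ₁ : ∀ ξ, |ξ| ≤ c → ψ ξ = 1) (hψ₀ : ∀ ξ, 1 - c ≤ |ξ| → ψ ξ = 0) {H : 𝓢(ℝ, ℂ)}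
    (hH : ∀ ξ, c < |ξ| → 𝓕 H ξ = 0) (x : ℝ) :
    H x = ∑' n : ℤ, 𝓕⁻ ψ (x - n) * H n := by
  have htg : Function.HasTemperateGrowth (fun u : ℝ => 𝓕⁻ ψ (x - u)) := by fun_prop
  set P : 𝓢(ℝ, ℂ) := SchwartzMap.smulLeftCLM ℂ (fun u : ℝ => 𝓕⁻ ψ (x - u)) H
  have hP : ∀ u, P u = 𝓕⁻ ψ (x - u) * H u := fun u => by
    simp [P, SchwartzMap.smulLeftCLM_apply_apply htg]
  have hPF : ∀ k : ℝ, 𝓕 P k = ∫ ξ, 𝐞 (ξ * x) * ψ ξ * 𝓕 H (ξ + k) := fun k => by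
    rw [← SchwartzMap.fourier_mul_fourierInv_sub, SchwartzMap.fourier_coe, funext hP]
  have hpoisson := SchwartzMap.tsum_eq_tsum_fourier P 0
  simp only [zero_add, hP] at hpoisson
  rw [hpoisson, tsum_eq_single 0]
  · have hinv : H x = 𝓕⁻ (𝓕 H) x := by simp
    rw [hPF, hinv, SchwartzMap.fourierInv_coe, Real.fourierInv_eq']
    simp only [Int.cast_zero, add_zero, fourier_zero, mul_one]
    congr 1 with ξ
    by_cases hξ : c < |ξ|
    · simp [hH ξ hξ]
    · rw [hψ₁ ξ (not_lt.mp hξ), Real.fourierChar_apply]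
      simp
      left
      ring_nf
  · intro k hk
    rw [hPF, integral_eq_zero_of_ae, zero_mul]
    refine Filter.Eventually.of_forall fun ξ => ?_
    by_cases hξ : c < |ξ + k|
    · simp [hH _ hξ]
    · have h1 : (1 : ℝ) ≤ |(k : ℝ)| := by exact_mod_cast Int.one_le_abs hk
      have h2 : |(k : ℝ)| ≤ |ξ + k| + |ξ| := by
        calc |(k : ℝ)| = |(ξ + k) - ξ| := by ring_nf
          _ ≤ _ := abs_sub _ _
      simp [hψ₀ ξ (by linarith [not_lt.mp hξ])]

theorem SchwartzMap.exists_tsum_enorm_rpow_sub_intCast_le (φ : 𝓢(ℝ, ℂ)) {r : ℝ} (hr : 0 < r) :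
    ∃ K : ℝ≥0, ∀ t : ℝ, ∑' n : ℤ, ‖φ (t - n)‖ₑ ^ r ≤ K := by
  obtain ⟨k, hk⟩ := exists_nat_ge (2 / r)
  obtain ⟨C, hC₀, hC⟩ : ∃ C : ℝ, 0 ≤ C ∧ ∀ x, (1 + |x|) ^ k * ‖φ x‖ ≤ C :=
    ⟨_, by positivity, fun x => le_trans (le_of_eq (by simp))
      (SchwartzMap.one_add_le_sup_seminorm_apply (𝕜 := ℝ) (m := (k, 0)) le_rfl le_rfl φ x)⟩
  have hdecay : ∀ x y : ℝ, |y| ≤ 2 * (1 + |x|) → y ≠ 0 →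
      ‖φ x‖ ^ r ≤ C ^ r * 4 * (1 / |y| ^ (2 : ℝ)) := by
    intro x y hxy hy
    have hy' : 0 < |y| := abs_pos.mpr hy
    have h1 : 1 ≤ 1 + |x| := by simp
    have h2 : ‖φ x‖ ≤ C * (1 + |x|) ^ (-(k : ℝ)) := by
      rw [Real.rpow_neg (by positivity), Real.rpow_natCast, ← div_eq_mul_inv,
        le_div_iff₀ (by positivity), mul_comm]
      exact hC x
    calc ‖φ x‖ ^ r ≤ (C * (1 + |x|) ^ (-(k : ℝ))) ^ r := by gcongr
      _ = C ^ r * (1 + |x|) ^ (-(k : ℝ) * r) := by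
        rw [Real.mul_rpow hC₀ (by positivity), ← Real.rpow_mul (by positivity)]
      _ ≤ C ^ r * (1 + |x|) ^ (-2 : ℝ) := by
        gcongr
        have := (div_le_iff₀ hr).mp hk
        linarith
      _ = C ^ r * (1 / (1 + |x|) ^ (2 : ℝ)) := by
        rw [Real.rpow_neg (by positivity), one_div]
      _ ≤ C ^ r * (4 * (1 / |y| ^ (2 : ℝ))) := by
        gcongr
        rw [mul_one_div, div_le_div_iff₀ (by positivity) (by positivity)]
        have h3 : |y| ^ 2 ≤ (2 * (1 + |x|)) ^ 2 := by gcongr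
        rw [Real.rpow_two, Real.rpow_two]
        linarith
      _ = _ := by ring
  have hsum : Summable fun n : ℤ => 1 / |(n : ℝ) + 1 / 2| ^ (2 : ℝ) :=
    (Real.summable_one_div_int_add_rpow (1 / 2) 2).mpr (by norm_num)
  have hnn : ∀ n : ℤ, 0 ≤ C ^ r * 4 * (1 / |(n : ℝ) + 1 / 2| ^ (2 : ℝ)) := fun n => by positivity
  refine ⟨Real.toNNReal (∑' n : ℤ, C ^ r * 4 * (1 / |(n : ℝ) + 1 / 2| ^ (2 : ℝ))), fun t => ?_⟩
  have hbound : ∀ n : ℤ, ‖φ (t - n)‖ₑ ^ r ≤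
      ENNReal.ofReal (C ^ r * 4 * (1 / |((n - ⌊t⌋ : ℤ) : ℝ) + 1 / 2| ^ (2 : ℝ))) := by
    intro n
    rw [← ofReal_norm, ENNReal.ofReal_rpow_of_nonneg (norm_nonneg _) hr.le]
    refine ENNReal.ofReal_le_ofReal (hdecay _ _ ?_ ?_)
    · have h1 := Int.floor_le t
      have h2 := Int.lt_floor_add_one t
      push_cast
      rw [abs_le]
      constructor
      · have := le_abs_self (t - n)
        linarith [abs_nonneg (t - n)]
      · have := neg_abs_le (t - n)
        linarith [abs_nonneg (t - n)]
    · intro h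
      have h3 : ((2 * (n - ⌊t⌋) + 1 : ℤ) : ℝ) = 0 := by
        push_cast at h ⊢
        linarith
      have h4 : 2 * (n - ⌊t⌋) + 1 = 0 := by exact_mod_cast h3
      omega
  calc ∑' n : ℤ, ‖φ (t - n)‖ₑ ^ r
      ≤ ∑' n : ℤ, ENNReal.ofReal (C ^ r * 4 * (1 / |((n - ⌊t⌋ : ℤ) : ℝ) + 1 / 2| ^ (2 : ℝ))) :=
        ENNReal.tsum_le_tsum hbound
    _ = ∑' n : ℤ, ENNReal.ofReal (C ^ r * 4 * (1 / |(n : ℝ) + 1 / 2| ^ (2 : ℝ))) :=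
        (Equiv.subRight ⌊t⌋).tsum_eq
          (fun n : ℤ => ENNReal.ofReal (C ^ r * 4 * (1 / |(n : ℝ) + 1 / 2| ^ (2 : ℝ))))
    _ = ENNReal.ofReal (∑' n : ℤ, C ^ r * 4 * (1 / |(n : ℝ) + 1 / 2| ^ (2 : ℝ))) :=
        (ENNReal.ofReal_tsum_of_nonneg hnn (hsum.mul_left _)).symm
    _ ≤ _ := le_rfl

theorem ENNReal.rpow_sum_le_sum_rpow {ι : Type*} (s : Finset ι) (a : ι → ℝ≥0∞) {p : ℝ}
    (hp : 0 < p) (hp₁ : p ≤ 1) : (∑ i ∈ s, a i) ^ p ≤ ∑ i ∈ s, a i ^ p := by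
  classical
  induction s using Finset.induction_on with
  | empty => simp [hp]
  | insert i s hi ih =>
    rw [Finset.sum_insert hi, Finset.sum_insert hi]
    exact (ENNReal.rpow_add_le_add_rpow _ _ hp.le hp₁).trans (by gcongr)

theorem ENNReal.rpow_tsum_le_of_forall_sum {ι : Type*} {a : ι → ℝ≥0∞} {p : ℝ} (hp : 0 < p)
    {C : ℝ≥0∞} (h : ∀ s : Finset ι, (∑ i ∈ s, a i) ^ p ≤ C) : (∑' i, a i) ^ p ≤ C := by
  rw [← ENNReal.le_rpow_inv_iff hp, ENNReal.tsum_eq_iSup_sum]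
  exact iSup_le fun s => (ENNReal.le_rpow_inv_iff hp).mpr (h s)

theorem ENNReal.rpow_tsum_le_tsum_rpow {ι : Type*} (a : ι → ℝ≥0∞) {p : ℝ} (hp : 0 < p)
    (hp₁ : p ≤ 1) : (∑' i, a i) ^ p ≤ ∑' i, a i ^ p :=
  ENNReal.rpow_tsum_le_of_forall_sum hp fun s =>
    (ENNReal.rpow_sum_le_sum_rpow s a hp hp₁).trans (ENNReal.sum_le_tsum s)

theorem ENNReal.rpow_tsum_mul_le {ι : Type*} (w a : ι → ℝ≥0∞) {p : ℝ} (hp : 1 ≤ p) :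
    (∑' i, w i * a i) ^ p ≤ (∑' i, w i) ^ (p - 1) * ∑' i, w i * a i ^ p := by
  have hp₀ : 0 < p := by linarith
  refine ENNReal.rpow_tsum_le_of_forall_sum hp₀ fun s => ?_
  calc (∑ i ∈ s, w i * a i) ^ p
      ≤ ((∑ i ∈ s, w i) ^ (1 - p⁻¹) * (∑ i ∈ s, w i * a i ^ p) ^ p⁻¹) ^ p := by
        gcongr
        exact ENNReal.inner_le_weight_mul_Lp_of_nonneg s hp w a
    _ = (∑ i ∈ s, w i) ^ (p - 1) * ∑ i ∈ s, w i * a i ^ p := by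
        rw [ENNReal.mul_rpow_of_nonneg _ _ hp₀.le, ENNReal.rpow_inv_rpow hp₀.ne',
          ← ENNReal.rpow_mul, sub_mul, inv_mul_cancel₀ hp₀.ne', one_mul]
    _ ≤ _ := by
        gcongr
        · exact ENNReal.sum_le_tsum s
        · exact ENNReal.sum_le_tsum s

/-- Schur's test for `ℓ^p`, `p ≤ 1`. -/
theorem ENNReal.tsum_rpow_le_of_le_one {ι κ : Type*} {u : ι → ℝ≥0∞} {v : κ → ℝ≥0∞}
    {k : ι → κ → ℝ≥0∞} {p : ℝ} (hp : 0 < p) (hp₁ : p ≤ 1) {A : ℝ≥0∞}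
    (hu : ∀ i, u i ≤ ∑' j, k i j * v j) (hA : ∀ j, ∑' i, k i j ^ p ≤ A) :
    ∑' i, u i ^ p ≤ A * ∑' j, v j ^ p :=
  calc ∑' i, u i ^ p ≤ ∑' i, ∑' j, k i j ^ p * v j ^ p := by
        refine ENNReal.tsum_le_tsum fun i => ?_
        calc u i ^ p ≤ (∑' j, k i j * v j) ^ p := by gcongr; exact hu i
          _ ≤ ∑' j, (k i j * v j) ^ p := ENNReal.rpow_tsum_le_tsum_rpow _ hp hp₁
          _ = _ := by simp only [ENNReal.mul_rpow_of_nonneg _ _ hp.le]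
    _ = ∑' j, (∑' i, k i j ^ p) * v j ^ p := by
        rw [ENNReal.tsum_comm]
        simp only [ENNReal.tsum_mul_right]
    _ ≤ ∑' j, A * v j ^ p := by
        gcongr with j
        exact hA j
    _ = _ := ENNReal.tsum_mul_left

/-- Schur's test for `ℓ^p`, `1 ≤ p`. -/
theorem ENNReal.tsum_rpow_le_of_one_le {ι κ : Type*} {u : ι → ℝ≥0∞} {v : κ → ℝ≥0∞}
    {k : ι → κ → ℝ≥0∞} {p : ℝ} (hp : 1 ≤ p) {A A' : ℝ≥0∞}
    (hu : ∀ i, u i ≤ ∑' j, k i j * v j) (hA : ∀ j, ∑' i, k i j ≤ A)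
    (hA' : ∀ i, ∑' j, k i j ≤ A') :
    ∑' i, u i ^ p ≤ A' ^ (p - 1) * A * ∑' j, v j ^ p :=
  calc ∑' i, u i ^ p ≤ ∑' i, A' ^ (p - 1) * ∑' j, k i j * v j ^ p := by
        refine ENNReal.tsum_le_tsum fun i => ?_
        calc u i ^ p ≤ (∑' j, k i j * v j) ^ p := by gcongr; exact hu i
          _ ≤ (∑' j, k i j) ^ (p - 1) * ∑' j, k i j * v j ^ p := ENNReal.rpow_tsum_mul_le _ _ hp
          _ ≤ _ := by
            gcongr
            exact hA' i
    _ = A' ^ (p - 1) * ∑' j, (∑' i, k i j) * v j ^ p := by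
        rw [ENNReal.tsum_mul_left, ENNReal.tsum_comm]
        simp only [ENNReal.tsum_mul_right]
    _ ≤ A' ^ (p - 1) * ∑' j, A * v j ^ p := by
        gcongr with j
        exact hA j
    _ = _ := by rw [ENNReal.tsum_mul_left, mul_assoc]

section BandLimited

variable {B : Type*} [NormedAddCommGroup B] [NormedSpace ℂ B]

theorem Real.fourier_comp_add_mul (g : ℝ → B) (a : ℝ) {Q : ℝ} (hQ : 0 < Q) (ξ : ℝ) :
    𝓕 (fun t : ℝ => g (a + Q * t)) ξ = Q⁻¹ • (𝐞 (a * (ξ / Q)) : ℂ) • 𝓕 g (ξ / Q) := by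
  have h : ∀ t : ℝ, 𝐞 (-(t * ξ)) • g (a + Q * t) =
      (𝐞 (a * (ξ / Q)) : ℂ) • (𝐞 (-((a + Q * t) * (ξ / Q))) • g (a + Q * t)) := by
    intro t
    rw [← Circle.smul_def, smul_smul, ← AddChar.map_add_eq_mul]
    congr 2
    field_simp
    ring
  rw [Real.fourier_real_eq, Real.fourier_real_eq]
  simp_rw [h]
  rw [integral_smul, Measure.integral_comp_mul_left
      (fun s : ℝ => 𝐞 (-((a + s) * (ξ / Q))) • g (a + s)),
    integral_add_left_eq_self (fun s : ℝ => 𝐞 (-(s * (ξ / Q))) • g s),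
    abs_of_pos (inv_pos.mpr hQ), smul_comm]

theorem SchwartzMap.enorm_le_tsum_of_fourier_eq_zero [CompleteSpace B] {c : ℝ} {ψ : 𝓢(ℝ, ℂ)}
    (hψ₁ : ∀ ξ, |ξ| ≤ c → ψ ξ = 1) (hψ₀ : ∀ ξ, 1 - c ≤ |ξ| → ψ ξ = 0) {Q : ℝ} (hQ : 0 < Q)
    {g : 𝓢(ℝ, B)} (hg : ∀ ξ, c / Q < |ξ| → 𝓕 g ξ = 0) (a t : ℝ) :
    ‖g (a + Q * t)‖ₑ ≤ ∑' n : ℤ, ‖𝓕⁻ ψ (t - n)‖ₑ * ‖g (a + Q * n)‖ₑ := by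
  obtain ⟨ℓ, hℓ, hℓx⟩ := exists_dual_vector'' ℂ (g (a + Q * t))
  have hanti : AntilipschitzWith (Real.toNNReal Q⁻¹) fun s : ℝ => a + Q * s := by
    refine AntilipschitzWith.of_le_mul_dist fun x y => ?_
    rw [Real.coe_toNNReal _ (by positivity), Real.dist_eq, Real.dist_eq, add_sub_add_left_eq_sub,
      ← mul_sub, abs_mul, abs_of_pos hQ, inv_mul_cancel_left₀ hQ.ne']
  have htg : Function.HasTemperateGrowth fun s : ℝ => a + Q * s := by fun_prop
  set H : 𝓢(ℝ, ℂ) := SchwartzMap.compCLMOfAntilipschitz ℂ htg hanti (g.postcompCLM ℓ)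
  have hH : ∀ s, H s = ℓ (g (a + Q * s)) := fun s => rfl
  have hHF : ∀ ξ, c < |ξ| → 𝓕 H ξ = 0 := by
    intro ξ hξ
    have h1 : 𝓕 (g : ℝ → B) (ξ / Q) = 0 := by
      rw [← SchwartzMap.fourier_coe]
      refine hg _ ?_
      rw [abs_div, abs_of_pos hQ]
      gcongr
    have h2 : 𝓕 (fun s => ℓ (g s)) (ξ / Q) = ℓ (𝓕 (g : ℝ → B) (ξ / Q)) := by
      have hint := (Real.fourierIntegral_convergent_iff (f := (g : ℝ → B)) (ξ / Q)).mpr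
        (g.integrable (μ := volume))
      rw [Real.fourier_eq, Real.fourier_eq, ← ContinuousLinearMap.integral_comp_comm _ hint]
      simp [Circle.smul_def]
    rw [SchwartzMap.fourier_coe, funext hH,
      Real.fourier_comp_add_mul (fun s => ℓ (g s)) a hQ, h2, h1]
    simp
  have hs := SchwartzMap.eq_tsum_mul_fourierInv hψ₁ hψ₀ hHF t
  have hle : ∀ y : B, ‖ℓ y‖ₑ ≤ ‖y‖ₑ := fun y => by
    rw [enorm_le_iff_norm_le]
    exact (ℓ.le_opNorm y).trans (mul_le_of_le_one_left (norm_nonneg _) hℓ)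
  calc ‖g (a + Q * t)‖ₑ = ‖H t‖ₑ := by
        rw [hH, hℓx, enorm_eq_iff_norm_eq]
        simp
    _ = ‖∑' n : ℤ, 𝓕⁻ ψ (t - n) * H n‖ₑ := by rw [hs]
    _ ≤ ∑' n : ℤ, ‖𝓕⁻ ψ (t - n) * H n‖ₑ := enorm_tsum_le_tsum_enorm
    _ ≤ _ := by
        gcongr with n
        rw [enorm_mul, hH]
        gcongr
        exact hle _

theorem exists_schwartz_cutoff {c : ℝ} (hc : 0 < c) (hc' : c < 1 / 2) : ∃ ψ : 𝓢(ℝ, ℂ),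
    (∀ ξ, |ξ| ≤ c → ψ ξ = 1) ∧ ∀ ξ, 1 - c ≤ |ξ| → ψ ξ = 0 := by
  let b : ContDiffBump (0 : ℝ) := ⟨c, 1 - c, hc, by linarith⟩
  have hsupp : HasCompactSupport fun ξ : ℝ => ((b ξ : ℝ) : ℂ) :=
    b.hasCompactSupport.comp_left (g := fun x : ℝ => (x : ℂ)) (by simp)
  have hsmooth : ContDiff ℝ ∞ fun ξ : ℝ => ((b ξ : ℝ) : ℂ) :=
    Complex.ofRealCLM.contDiff.comp b.contDiff
  have hval : ∀ ξ, hsupp.toSchwartzMap hsmooth ξ = ((b ξ : ℝ) : ℂ) := fun ξ => rfl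
  refine ⟨hsupp.toSchwartzMap hsmooth, fun ξ hξ => ?_, fun ξ hξ => ?_⟩
  · rw [hval, b.one_of_mem_closedBall (by simpa [b] using hξ), Complex.ofReal_one]
  · rw [hval, b.zero_of_le_dist (by simpa [b] using hξ), Complex.ofReal_zero]

/-- Comparison of the `ℓ^p` quasi-norms of a band-limited function along two translates of the
lattice `Qℤ`. -/
theorem exists_tsum_enorm_rpow_le {c : ℝ} (hc : 0 < c) (hc' : c < 1 / 2) {p : ℝ} (hp : 0 < p) :
    ∃ K : ℝ≥0, ∀ (B : Type*) [NormedAddCommGroup B] [NormedSpace ℂ B] [CompleteSpace B] (Q : ℝ)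
      (g : 𝓢(ℝ, B)), 0 < Q → (∀ ξ, c / Q < |ξ| → 𝓕 g ξ = 0) → ∀ a b : ℝ,
        ∑' n : ℤ, ‖g (a + Q * n)‖ₑ ^ p ≤ K * ∑' n : ℤ, ‖g (b + Q * n)‖ₑ ^ p := by
  obtain ⟨ψ, hψ₁, hψ₀⟩ := exists_schwartz_cutoff hc hc'
  have hcol : ∀ {r : ℝ} {K : ℝ≥0}, (∀ t : ℝ, ∑' n : ℤ, ‖𝓕⁻ ψ (t - n)‖ₑ ^ r ≤ K) →
      ∀ (s : ℝ) (n : ℤ), ∑' m : ℤ, ‖𝓕⁻ ψ (s + m - n)‖ₑ ^ r ≤ K := by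
    intro r K h s n
    refine le_trans (le_of_eq ?_) (h (s - n))
    rw [← (Equiv.neg ℤ).tsum_eq]
    congr with m
    simp only [Equiv.neg_apply, Int.cast_neg]
    ring_nf
  have hpt : ∀ (B : Type _) [NormedAddCommGroup B] [NormedSpace ℂ B] [CompleteSpace B] (Q : ℝ)
      (g : 𝓢(ℝ, B)), 0 < Q → (∀ ξ, c / Q < |ξ| → 𝓕 g ξ = 0) → ∀ (a b : ℝ) (m : ℤ),
      ‖g (a + Q * m)‖ₑ ≤ ∑' n : ℤ, ‖𝓕⁻ ψ ((a - b) / Q + m - n)‖ₑ * ‖g (b + Q * n)‖ₑ := by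
    intro B _ _ _ Q g hQ hg a b m
    have := SchwartzMap.enorm_le_tsum_of_fourier_eq_zero hψ₁ hψ₀ hQ hg b ((a - b) / Q + m)
    rwa [show b + Q * ((a - b) / Q + m) = a + Q * m by field_simp; ring] at this
  rcases le_total p 1 with hp₁ | hp₁
  · obtain ⟨K, hK⟩ := (𝓕⁻ ψ).exists_tsum_enorm_rpow_sub_intCast_le hp
    exact ⟨K, fun B _ _ _ Q g hQ hg a b => ENNReal.tsum_rpow_le_of_le_one hp hp₁
      (hpt B Q g hQ hg a b) (hcol hK _)⟩
  · obtain ⟨K, hK⟩ := (𝓕⁻ ψ).exists_tsum_enorm_rpow_sub_intCast_le one_pos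
    refine ⟨K ^ (p - 1) * K, fun B _ _ _ Q g hQ hg a b => ?_⟩
    have := ENNReal.tsum_rpow_le_of_one_le hp₁ (hpt B Q g hQ hg a b) (A := K) (A' := K)
      (fun n => by simpa using hcol hK ((a - b) / Q) n)
      (fun m => by simpa using hK ((a - b) / Q + m))
    rwa [ENNReal.coe_mul, ENNReal.coe_rpow_of_nonneg _ (by linarith)]

theorem exists_enorm_le_iSup {c : ℝ} (hc : 0 < c) (hc' : c < 1 / 2) :
    ∃ K : ℝ≥0, ∀ (B : Type*) [NormedAddCommGroup B] [NormedSpace ℂ B] [CompleteSpace B] (Q : ℝ)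
      (g : 𝓢(ℝ, B)), 0 < Q → (∀ ξ, c / Q < |ξ| → 𝓕 g ξ = 0) → ∀ a x : ℝ,
        ‖g x‖ₑ ≤ K * ⨆ n : ℤ, ‖g (a + Q * n)‖ₑ := by
  obtain ⟨ψ, hψ₁, hψ₀⟩ := exists_schwartz_cutoff hc hc'
  obtain ⟨K, hK⟩ := (𝓕⁻ ψ).exists_tsum_enorm_rpow_sub_intCast_le one_pos
  refine ⟨K, fun B _ _ _ Q g hQ hg a x => ?_⟩
  have := SchwartzMap.enorm_le_tsum_of_fourier_eq_zero hψ₁ hψ₀ hQ hg a ((x - a) / Q)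
  rw [show a + Q * ((x - a) / Q) = x by field_simp; ring] at this
  refine this.trans ?_
  calc _ ≤ ∑' n : ℤ, ‖𝓕⁻ ψ ((x - a) / Q - n)‖ₑ * ⨆ n : ℤ, ‖g (a + Q * n)‖ₑ := by
        gcongr with n
        exact le_iSup (fun n : ℤ => ‖g (a + Q * n)‖ₑ) n
    _ ≤ _ := by
        rw [ENNReal.tsum_mul_right]
        gcongr
        simpa using hK ((x - a) / Q)

end BandLimited

namespace Adelic

theorem modHom_intCast (n : ℕ) [NeZero n] (k : ℤ) : modHom n (k : ZHat) = k := map_intCast _ k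

theorem natCast_dvd_of_pow_factorization_dvd {p : ℕ} [hp : Fact p.Prime] {n : ℕ} (hn : n ≠ 0)
    {y : ℤ_[p]} (hy : (p : ℤ_[p]) ^ n.factorization p ∣ y) : (n : ℤ_[p]) ∣ y := by
  have hu : IsUnit ((n / p ^ n.factorization p : ℕ) : ℤ_[p]) := by
    rw [PadicInt.isUnit_iff, PadicInt.norm_natCast_eq_one_iff]
    exact Nat.coprime_ordCompl hp.out hn
  rw [← Nat.ordProj_mul_ordCompl_eq_self n p, Nat.cast_mul, hu.mul_right_dvd, Nat.cast_pow]
  exact hy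

theorem exists_natCast_mul_eq_of_modHom_eq_zero {n : ℕ} [NeZero n] {y : ZHat}
    (hy : modHom n y = 0) : ∃ z : ZHat, (n : ZHat) * z = y := by
  have hcomp : ∀ p : Nat.Primes, (n : ℤ_[(p : ℕ)]) ∣ y p := by
    intro p
    refine natCast_dvd_of_pow_factorization_dvd (NeZero.ne n) ?_
    by_cases hp : (p : ℕ) ∣ n
    · have hmem : (p : ℕ) ∈ n.primeFactors := Nat.mem_primeFactors.mpr ⟨p.2, hp, NeZero.ne n⟩
      have h0 := (map_eq_zero_iff _ (ZMod.equivPi n (NeZero.ne n)).symm.injective).mp hy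
      have h1 : PadicInt.toZModPow (p := (p : ℕ)) (n.factorization p) (y p) = 0 :=
        congr_fun h0 ⟨(p : ℕ), hmem⟩
      rwa [← RingHom.mem_ker, PadicInt.ker_toZModPow, Ideal.mem_span_singleton] at h1
    · simp [Nat.factorization_eq_zero_of_not_dvd hp]
  choose z hz using hcomp
  exact ⟨z, funext fun p => (hz p).symm⟩

theorem exists_eq_intCast_add_natCast_mul (n : ℕ) [NeZero n] (y : ZHat) :
    ∃ (k : ℤ) (z : ZHat), y = k + n * z := by
  obtain ⟨k, hk⟩ := ZMod.intCast_surjective (modHom n y)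
  obtain ⟨z, hz⟩ := exists_natCast_mul_eq_of_modHom_eq_zero (n := n) (y := y - k)
    (by rw [map_sub, modHom_intCast, hk, sub_self])
  exact ⟨k, z, by rw [hz]; ring⟩

theorem eq_modHom {n : ℕ} [NeZero n] (φ : ZHat →+* ZMod n) : φ = modHom n := by
  ext y
  obtain ⟨k, z, rfl⟩ := exists_eq_intCast_add_natCast_mul n y
  simp

theorem castHom_modHom {d n : ℕ} [NeZero d] [NeZero n] (h : d ∣ n) (y : ZHat) :
    ZMod.castHom h (ZMod d) (modHom n y) = modHom d y :=
  congr($(eq_modHom ((ZMod.castHom h (ZMod d)).comp (modHom n))) y)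

theorem modHom_surjective (n : ℕ) [NeZero n] : Function.Surjective (modHom n) := fun b => by
  obtain ⟨k, rfl⟩ := ZMod.intCast_surjective b
  exact ⟨k, modHom_intCast n k⟩

theorem preimage_modHom_intCast (n : ℕ) [NeZero n] (k : ℤ) :
    modHom n ⁻¹' {(k : ZMod n)} = Set.range fun z : ZHat => (k : ZHat) + n * z := by
  ext y
  constructor
  · intro hy
    have hy' : modHom n y = k := hy
    obtain ⟨z, hz⟩ := exists_natCast_mul_eq_of_modHom_eq_zero (n := n) (y := y - k)
      (by rw [map_sub, modHom_intCast, hy', sub_self])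
    exact ⟨z, by simp only [hz]; ring⟩
  · rintro ⟨z, rfl⟩
    simp

theorem continuous_modHom (n : ℕ) [NeZero n] : Continuous (modHom n) := by
  refine continuous_iff_isClosed.mpr fun s _ => ?_
  rw [← Set.biUnion_preimage_singleton]
  refine s.toFinite.isClosed_biUnion fun b _ => ?_
  obtain ⟨k, rfl⟩ := ZMod.intCast_surjective b
  rw [preimage_modHom_intCast]
  exact (isCompact_range (by fun_prop)).isClosed

instance : haarZHat.IsAddHaarMeasure := by
  unfold haarZHat
  infer_instance

theorem measurePreserving_modHom (n : ℕ) [NeZero n] :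
    MeasurePreserving (modHom n) haarZHat ((n : ℝ≥0∞)⁻¹ • Measure.count) := by
  have hmeas : Measurable (modHom n) := (continuous_modHom n).measurable
  refine ⟨hmeas, ?_⟩
  have hconst : ∀ b : ZMod n, haarZHat (modHom n ⁻¹' {b}) = haarZHat (modHom n ⁻¹' {0}) := by
    intro b
    obtain ⟨y, rfl⟩ := modHom_surjective n b
    rw [← measure_preimage_add haarZHat y (modHom n ⁻¹' {modHom n y})]
    congr 1
    ext z
    simp
  have hsum : ∑ b : ZMod n, haarZHat (modHom n ⁻¹' {b}) = 1 := by
    have := sum_measure_preimage_singleton (μ := haarZHat) (f := modHom n) Finset.univ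
      (fun b _ => hmeas (measurableSet_singleton b))
    rw [this]
    simp
  simp_rw [hconst, Finset.sum_const, Finset.card_univ, ZMod.card, nsmul_eq_mul] at hsum
  refine Measure.ext_of_singleton fun b => ?_
  rw [Measure.map_apply hmeas (measurableSet_singleton b), hconst]
  simp only [Measure.smul_apply, Measure.count_singleton, smul_eq_mul, mul_one]
  exact ENNReal.eq_inv_of_mul_eq_one_left (by rwa [mul_comm])

theorem measurePreserving_prodMap_modHom (n : ℕ) [NeZero n] :
    MeasurePreserving (Prod.map id (modHom n)) haarAZ
      ((volume : Measure ℝ).prod ((n : ℝ≥0∞)⁻¹ • Measure.count)) :=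
  (MeasurePreserving.id _).prod (measurePreserving_modHom n)

theorem pairZHat_intCast_div (n : ℕ) [NeZero n] (y : ZHat) (a : ℤ) :
    pairZHat y ((a / n : ℚ) : QModZ) = ZMod.toAddCircle (modHom n y * (a : ZMod n)) := by
  set r : ℚ := a / n with hr
  have : NeZero r.den := ⟨r.den_nz⟩
  have hdvd : r.den ∣ n := by
    rw [hr, ← Int.cast_natCast n, ← Rat.divInt_eq_div]
    exact_mod_cast Rat.den_dvd a n
  obtain ⟨k, z, rfl⟩ := exists_eq_intCast_add_natCast_mul n y
  obtain ⟨m, hm⟩ := hdvd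
  have h1 : modHom r.den ((k : ZHat) + (n : ZHat) * z) = k := by
    conv_lhs => rw [hm]
    simp
  have h2 : modHom n ((k : ZHat) + (n : ZHat) * z) = k := by simp
  change pairFrac _ r.num r.den = _
  rw [pairFrac, h1, h2, ← Int.cast_mul, ← Int.cast_mul, ZMod.toAddCircle_intCast,
    ZMod.toAddCircle_intCast]
  congr 1
  have h3 : ((r.num : ℚ) : ℝ) / ((r.den : ℚ) : ℝ) = a / n := by
    rw [← Rat.cast_div, Rat.num_div_den, hr]
    push_cast
    rfl
  push_cast at h3 ⊢
  rw [mul_div_assoc, mul_div_assoc, h3]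

section Functions

variable {B : Type*} [NormedAddCommGroup B] [NormedSpace ℂ B]

theorem continuous_uncurry_schwartz {n : ℕ} (f : ZMod n → 𝓢(ℝ, B)) :
    Continuous fun w : ℝ × ZMod n => f w.2 w.1 := by
  rw [continuous_prod_of_discrete_right]
  exact fun b => (f b).continuous

theorem toCircle_pairAZ (n : ℕ) [NeZero n] (x : ℝ) (y : ZHat) (ξ : ℝ) (a : ℤ) :
    (AddCircle.toCircle (pairAZ (x, y) (ξ, ((a / n : ℚ) : QModZ))) : ℂ) =
      (𝐞 (-(x * -ξ)) : ℂ) * ZMod.stdAddChar (modHom n y * (a : ZMod n)) := by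
  rw [pairAZ, pairZHat_intCast_div, AddCircle.toCircle_add, Circle.coe_mul]
  congr 1
  rw [AddCircle.toCircle_apply_mk, Real.fourierChar_apply']
  congr 2
  ring

theorem fourierAZ_eq [CompleteSpace B] {n : ℕ} [NeZero n] {F : AZ → B} {f : ZMod n → 𝓢(ℝ, B)}
    (hF : ∀ x y, F (x, y) = f (modHom n y) x) (ξ : ℝ) (a : ℤ) :
    fourierAZ F (ξ, ((a / n : ℚ) : QModZ)) =
      (n : ℝ)⁻¹ • ∑ b : ZMod n, (ZMod.stdAddChar (b * (a : ZMod n)) : ℂ) • 𝓕 (f b) (-ξ) := by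
  set G : ℝ × ZMod n → B := fun w =>
    ((𝐞 (-(w.1 * -ξ)) : ℂ) * ZMod.stdAddChar (w.2 * (a : ZMod n))) • f w.2 w.1 with hG
  have hGc : Continuous G := by
    have h1 := continuous_uncurry_schwartz f
    have h2 : Continuous fun w : ℝ × ZMod n => (ZMod.stdAddChar (w.2 * (a : ZMod n)) : ℂ) :=
      (continuous_of_discreteTopology
        (f := fun b : ZMod n => (ZMod.stdAddChar (b * (a : ZMod n)) : ℂ))).comp continuous_snd
    have h3 : Continuous fun w : ℝ × ZMod n => (𝐞 (-(w.1 * -ξ)) : ℂ) :=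
      continuous_subtype_val.comp (Real.continuous_fourierChar.comp (by fun_prop))
    exact (h3.mul h2).smul h1
  have hslice : ∀ b : ZMod n, Integrable fun x : ℝ => G (x, b) := by
    intro b
    refine (f b).integrable.norm.mono'
      (hGc.comp (by fun_prop : Continuous fun x : ℝ => (x, b))).aestronglyMeasurable
      (Filter.Eventually.of_forall fun x => ?_)
    simp only [hG, norm_smul, norm_mul, Circle.norm_coe, ZMod.stdAddChar_apply, one_mul]
    exact le_rfl
  have hint : Integrable G ((volume : Measure ℝ).prod ((n : ℝ≥0∞)⁻¹ • Measure.count)) := by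
    rw [integrable_prod_iff' hGc.aestronglyMeasurable]
    refine ⟨Filter.Eventually.of_forall hslice, ?_⟩
    exact (Integrable.of_finite (μ := Measure.count)).smul_measure
      (ENNReal.inv_ne_top.mpr (by exact_mod_cast NeZero.ne n))
  have hmp := measurePreserving_prodMap_modHom n
  have h1 : fourierAZ F (ξ, ((a / n : ℚ) : QModZ)) =
      ∫ w, G w ∂(volume : Measure ℝ).prod ((n : ℝ≥0∞)⁻¹ • Measure.count) := by
    rw [← hmp.map_eq, integral_map hmp.measurable.aemeasurable
      hGc.aestronglyMeasurable, fourierAZ]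
    congr 1 with z
    rcases z with ⟨x, y⟩
    rw [toCircle_pairAZ, hF]
    rfl
  rw [h1, integral_prod_symm _ hint, integral_smul_measure, integral_count]
  congr 1
  · simp
  · refine Finset.sum_congr rfl fun b _ => ?_
    rw [SchwartzMap.fourier_coe, Real.fourier_real_eq, ← integral_smul]
    congr 1 with x
    simp only [hG]
    rw [mul_comm, mul_smul, Circle.smul_def]

end Functions

theorem natCast_mul_eq_zero_of_mem_fracSubgroup {q Q : ℕ} [NeZero q] [NeZero Q] {a : ℤ}
    (h : ((a / (q * Q : ℕ) : ℚ) : QModZ) ∈ fracSubgroup Q) : (Q : ZMod (q * Q)) * a = 0 := by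
  obtain ⟨a', ha'⟩ := h
  obtain ⟨k, hk⟩ := AddSubgroup.mem_zmultiples_iff.mp (QuotientAddGroup.eq.mp ha')
  have hq : (q : ℚ) ≠ 0 := by exact_mod_cast NeZero.ne q
  have hQ : (Q : ℚ) ≠ 0 := by exact_mod_cast NeZero.ne Q
  have h1 : (a : ℚ) = a' * q - k * (q * Q) := by
    simp at hk
    field_simp at hk
    linarith
  have h2 : a = a' * q - k * (q * Q) := by exact_mod_cast h1
  rw [h2, ← Int.cast_natCast Q, ← Int.cast_mul, ZMod.intCast_zmod_eq_zero_iff_dvd]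
  exact ⟨a' - k * Q, by push_cast; ring⟩

section Functions

variable {B : Type*} [NormedAddCommGroup B] [NormedSpace ℂ B]

theorem _root_.ZMod.eq_of_dft_eq_zero {n : ℕ} [NeZero n] {Φ : ZMod n → B} {d : ZMod n}
    (h : ∀ k : ZMod n, d * k ≠ 0 → ZMod.dft Φ k = 0) (b : ZMod n) : Φ (b + d) = Φ b := by
  suffices (fun b => Φ (b + d)) = Φ from congr_fun this b
  apply ZMod.dft.injective
  ext k
  have hshift : ZMod.dft (fun b => Φ (b + d)) k = (ZMod.stdAddChar (d * k) : ℂ) • ZMod.dft Φ k := by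
    rw [ZMod.dft_apply, ZMod.dft_apply, Finset.smul_sum]
    refine Fintype.sum_equiv (Equiv.addRight d) _ _ fun j => ?_
    rw [Equiv.coe_addRight, smul_smul, ← AddChar.map_add_eq_mul]
    congr 2
    ring
  rw [hshift]
  by_cases hk : d * k = 0
  · simp [hk]
  · simp [h k hk]

/-- A Schwartz–Bruhat function with Fourier support in `[-c/Q, c/Q] × (1/Q)ℤ/ℤ` factors through
`ℝ × ℤ/Qℤ`, with band-limited components. -/
theorem exists_eq_modHom_of_fourierSupportedIn [CompleteSpace B] {c : ℝ} {Q : ℕ} [NeZero Q]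
    {F : AZ → B} (hF : IsSchwartzBruhat F)
    (hsupp : FourierSupportedIn F (Set.Icc (-(c / Q)) (c / Q) ×ˢ fracSubgroup Q)) :
    ∃ g : ZMod Q → 𝓢(ℝ, B), (∀ x y, F (x, y) = g (modHom Q y) x) ∧
      ∀ b ξ, c / Q < |ξ| → 𝓕 (g b) ξ = 0 := by
  obtain ⟨q, hq, f₀, hf₀⟩ := hF
  have hN : NeZero (q * Q) := ⟨mul_ne_zero hq.out (NeZero.ne Q)⟩
  set f : ZMod (q * Q) → 𝓢(ℝ, B) := fun b => f₀ (ZMod.castHom (dvd_mul_right q Q) (ZMod q) b)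
  have hf : ∀ x y, F (x, y) = f (modHom (q * Q) y) x := fun x y => by
    simp only [f, castHom_modHom, hf₀]
  have hdft : ∀ᵐ ξ : ℝ, ∀ a : ℤ,
      (ξ, ((a / (q * Q : ℕ) : ℚ) : QModZ)) ∉ Set.Icc (-(c / Q)) (c / Q) ×ˢ fracSubgroup Q →
      ZMod.dft (fun b => 𝓕 (f b) (-ξ)) (-(a : ZMod (q * Q))) = 0 := by
    filter_upwards [Measure.ae_ae_of_ae_prod hsupp] with ξ hξ a ha
    rw [Measure.ae_count_iff] at hξ
    have h := hξ _ ha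
    rw [fourierAZ_eq hf, smul_eq_zero] at h
    have hN0 : ((q * Q : ℕ) : ℝ)⁻¹ ≠ 0 := inv_ne_zero (by exact_mod_cast hN.out)
    rw [ZMod.dft_apply]
    simpa using h.resolve_left hN0
  have hcont : ∀ b, Continuous fun ξ : ℝ => 𝓕 (f b) (-ξ) := fun b => by fun_prop
  have hband : ∀ b ξ, c / Q < |ξ| → 𝓕 (f b) ξ = 0 := by
    intro b ξ hξ
    have hopen : IsOpen {ξ : ℝ | c / Q < |ξ|} := isOpen_lt continuous_const continuous_abs
    have hae : (fun ξ : ℝ => 𝓕 (f b) (-ξ)) =ᵐ[volume.restrict {ξ : ℝ | c / Q < |ξ|}] 0 := by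
      refine (ae_restrict_iff' hopen.measurableSet).mpr ?_
      filter_upwards [hdft] with ξ hξ hlt
      have hzero : (fun b => 𝓕 (f b) (-ξ)) = 0 := by
        apply ZMod.dft.injective
        ext k
        obtain ⟨a, ha⟩ := ZMod.intCast_surjective (-k)
        rw [map_zero, ← neg_neg k, ← ha]
        exact hξ a fun hmem => not_le.mpr hlt (abs_le.mpr hmem.1)
      exact congr_fun hzero b
    have := Measure.eqOn_open_of_ae_eq hae hopen (hcont b).continuousOn continuousOn_const
      (x := -ξ) (by simpa using hξ)
    simpa using this
  have hper : ∀ b, f (b + (Q : ZMod (q * Q))) = f b := by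
    intro b
    have hae : (fun ξ : ℝ => 𝓕 (f (b + (Q : ZMod (q * Q)))) (-ξ)) =ᵐ[volume]
        fun ξ : ℝ => 𝓕 (f b) (-ξ) := by
      filter_upwards [hdft] with ξ hξ
      refine ZMod.eq_of_dft_eq_zero (Φ := fun b => 𝓕 (f b) (-ξ)) (fun k hk => ?_) b
      obtain ⟨a, ha⟩ := ZMod.intCast_surjective (-k)
      rw [← neg_neg k, ← ha]
      refine hξ a fun hmem => hk ?_
      have := natCast_mul_eq_zero_of_mem_fracSubgroup hmem.2
      rwa [ha, mul_neg, neg_eq_zero] at this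
    have heq := (Continuous.ae_eq_iff_eq volume (hcont _) (hcont _)).mp hae
    have hF : 𝓕 (f (b + (Q : ZMod (q * Q)))) = 𝓕 (f b) := by
      ext ξ
      simpa using congr_fun heq (-ξ)
    simpa using congr(𝓕⁻ $hF)
  have hper' : ∀ (k : ℤ) (b : ZMod (q * Q)), f (b + k * (Q : ZMod (q * Q))) = f b := fun k =>
    Function.Periodic.int_mul hper k
  refine ⟨fun b => f ((b.val : ℤ) : ZMod (q * Q)), fun x y => ?_, fun b => hband _⟩
  obtain ⟨k, z, rfl⟩ := exists_eq_intCast_add_natCast_mul (q * Q) y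
  have h1 : modHom (q * Q) ((k : ZHat) + ((q * Q : ℕ) : ZHat) * z) = k := by
    rw [map_add, map_mul, map_natCast, ZMod.natCast_self, map_intCast, zero_mul, add_zero]
  have h2 : modHom Q ((k : ZHat) + ((q * Q : ℕ) : ZHat) * z) = k := by simp
  rw [hf, h1, h2]
  dsimp only
  rw [ZMod.val_intCast]
  conv_lhs => rw [← Int.emod_add_mul_ediv k Q]
  rw [← hper' (k / Q) ((k % Q : ℤ) : ZMod (q * Q))]
  congr 2
  push_cast
  ring

end Functions

/-- The decomposition of `ℤ` into residue classes modulo `Q`. -/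
def zmodProdIntEquiv (Q : ℕ) [NeZero Q] : ZMod Q × ℤ ≃ ℤ where
  toFun w := w.1.val + Q * w.2
  invFun n := (n, n / Q)
  left_inv w := by
    have hQ : (Q : ℤ) ≠ 0 := by exact_mod_cast NeZero.ne Q
    ext
    · simp
    · have h : ((w.1.val : ℤ)) / Q = 0 :=
        Int.ediv_eq_zero_of_lt (by positivity) (by exact_mod_cast w.1.val_lt)
      dsimp only
      rw [Int.add_mul_ediv_left _ _ hQ, h, zero_add]
  right_inv n := by
    dsimp only
    rw [ZMod.val_intCast, Int.emod_add_mul_ediv]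

theorem lintegral_eq_lintegral_tsum {T : ℝ} (hT : 0 < T) {u : ℝ → ℝ≥0∞} (hu : Measurable u) :
    ∫⁻ x, u x = ∫⁻ x in Set.Ioc 0 T, ∑' n : ℤ, u (x + T * n) := by
  have h := (isAddFundamentalDomain_Ioc hT 0 volume).lintegral_eq_tsum'' u
  rw [h, zero_add, lintegral_tsum fun n => (by fun_prop)]
  have hinj : Function.Injective fun n : ℤ => n • T := fun m n hmn => by
    simpa [hT.ne'] using hmn
  have hreindex := (Equiv.ofInjective _ hinj).tsum_eq
    fun G : AddSubgroup.zmultiples T => ∫⁻ x in Set.Ioc 0 T, u (G +ᵥ x)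
  refine hreindex.symm.trans ?_
  refine tsum_congr fun n => lintegral_congr fun x => ?_
  congr 1
  change n • T + x = _
  rw [zsmul_eq_mul]
  ring

section Functions

variable {B : Type*} [NormedAddCommGroup B] [NormedSpace ℂ B]

theorem tsum_sampling {Q : ℕ} [NeZero Q] {F : AZ → B} {g : ZMod Q → 𝓢(ℝ, B)}
    (hg : ∀ x y, F (x, y) = g (modHom Q y) x) (r : ℝ) :
    ∑' n : ℤ, ‖sampling F n‖ₑ ^ r =
      ∑ b : ZMod Q, ∑' m : ℤ, ‖g b ((b.val : ℝ) + Q * m)‖ₑ ^ r := by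
  rw [← (zmodProdIntEquiv Q).tsum_eq, ENNReal.tsum_prod'
    (f := fun w => ‖sampling F (zmodProdIntEquiv Q w)‖ₑ ^ r), tsum_fintype]
  refine Finset.sum_congr rfl fun b _ => tsum_congr fun m => ?_
  rw [sampling, iota, hg, modHom_intCast]
  simp [zmodProdIntEquiv]

theorem sampling_eq {Q : ℕ} [NeZero Q] {F : AZ → B} {g : ZMod Q → 𝓢(ℝ, B)}
    (hg : ∀ x y, F (x, y) = g (modHom Q y) x) (b : ZMod Q) (m : ℤ) :
    sampling F (b.val + Q * m) = g b ((b.val : ℝ) + Q * m) := by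
  rw [sampling, iota, hg, modHom_intCast]
  simp

theorem lintegral_haarAZ {Q : ℕ} [NeZero Q] {F : AZ → B} {g : ZMod Q → 𝓢(ℝ, B)}
    (hg : ∀ x y, F (x, y) = g (modHom Q y) x) (r : ℝ) :
    ∫⁻ z, ‖F z‖ₑ ^ r ∂haarAZ = (Q : ℝ≥0∞)⁻¹ * ∑ b : ZMod Q, ∫⁻ x in Set.Ioc 0 (Q : ℝ),
      ∑' n : ℤ, ‖g b (x + Q * n)‖ₑ ^ r := by
  have hQ : (0 : ℝ) < Q := by exact_mod_cast NeZero.pos Q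
  have hmp := measurePreserving_prodMap_modHom Q
  have hmeas : Measurable fun w : ℝ × ZMod Q => ‖g w.2 w.1‖ₑ ^ r :=
    (continuous_uncurry_schwartz g).enorm.measurable.pow_const r
  have h1 : ∀ z : AZ, ‖F z‖ₑ ^ r =
      (fun w : ℝ × ZMod Q => ‖g w.2 w.1‖ₑ ^ r) (Prod.map id (modHom Q) z) := fun z =>
    congr(‖$(hg z.1 z.2)‖ₑ ^ r)
  simp_rw [h1]
  rw [hmp.lintegral_comp hmeas, lintegral_prod_symm _ hmeas.aemeasurable, lintegral_smul_measure,
    lintegral_count, tsum_fintype, smul_eq_mul]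
  congr 1
  refine Finset.sum_congr rfl fun b _ => ?_
  exact lintegral_eq_lintegral_tsum hQ ((g b).continuous.enorm.measurable.pow_const r)

theorem enorm_le_eLpNormEssSup_haarAZ {Q : ℕ} [NeZero Q] {F : AZ → B} {g : ZMod Q → 𝓢(ℝ, B)}
    (hg : ∀ x y, F (x, y) = g (modHom Q y) x) (z : AZ) : ‖F z‖ₑ ≤ eLpNormEssSup F haarAZ := by
  have hcont : Continuous F := by
    have h : F = (fun w : ℝ × ZMod Q => g w.2 w.1) ∘ Prod.map id (modHom Q) :=
      funext fun z => hg z.1 z.2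
    rw [h]
    exact (continuous_uncurry_schwartz g).comp (continuous_id.prodMap (continuous_modHom Q))
  have hpos : haarAZ.IsOpenPosMeasure := by
    unfold haarAZ
    infer_instance
  by_contra! hlt
  have hopen : IsOpen {w : AZ | eLpNormEssSup F haarAZ < ‖F w‖ₑ} :=
    isOpen_lt continuous_const hcont.enorm
  refine hopen.measure_ne_zero haarAZ ⟨z, hlt⟩ ?_
  have h := enorm_ae_le_eLpNormEssSup F haarAZ
  rw [ae_iff] at h
  simpa only [not_le] using h

end Functions

theorem exists_rpow_bounds {p : ℝ} (hp : 0 < p) {c : ℝ} (hc : 0 < c) (hc' : c < 1 / 2) :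
    ∃ K : ℝ≥0, ∀ (B : Type*) [NormedAddCommGroup B] [NormedSpace ℂ B] [CompleteSpace B]
      (Q : ℕ) [NeZero Q] (F : AZ → B) (g : ZMod Q → 𝓢(ℝ, B)),
      (∀ x y, F (x, y) = g (modHom Q y) x) → (∀ b ξ, c / Q < |ξ| → 𝓕 (g b) ξ = 0) →
      ∑' n : ℤ, ‖sampling F n‖ₑ ^ p ≤ K * ∫⁻ z, ‖F z‖ₑ ^ p ∂haarAZ ∧
      ∫⁻ z, ‖F z‖ₑ ^ p ∂haarAZ ≤ K * ∑' n : ℤ, ‖sampling F n‖ₑ ^ p := by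
  obtain ⟨K, hK⟩ := exists_tsum_enorm_rpow_le hc hc' hp
  refine ⟨K, fun B _ _ _ Q _ F g hg hband => ?_⟩
  have hQ : (0 : ℝ) < Q := by exact_mod_cast NeZero.pos Q
  have hQ0 : (Q : ℝ≥0∞) ≠ 0 := by exact_mod_cast NeZero.ne Q
  have hcst : ∀ C : ℝ≥0∞, ∫⁻ _ in Set.Ioc 0 (Q : ℝ), C = Q * C := fun C => by
    simp [mul_comm]
  have hcancel : ∀ C : ℝ≥0∞, (Q : ℝ≥0∞)⁻¹ * (Q * C) = C := fun C => by
    rw [← mul_assoc, ENNReal.inv_mul_cancel hQ0 (ENNReal.natCast_ne_top Q), one_mul]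
  have hmeas : ∀ b, Measurable fun x : ℝ => ∑' n : ℤ, ‖g b (x + Q * n)‖ₑ ^ p := fun b =>
    Measurable.tsum fun n =>
      ((g b).continuous.comp (by fun_prop)).enorm.measurable.pow_const p
  rw [tsum_sampling hg, lintegral_haarAZ hg]
  constructor
  · rw [← hcancel (∑ b : ZMod Q, _), mul_left_comm (K : ℝ≥0∞)]
    refine mul_le_mul_of_nonneg_left ?_ zero_le
    rw [Finset.mul_sum, Finset.mul_sum]
    refine Finset.sum_le_sum fun b _ => ?_
    rw [← hcst, ← lintegral_const_mul _ (hmeas b)]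
    exact lintegral_mono fun x => hK B Q (g b) hQ (hband b) _ _
  · rw [← hcancel (K * _)]
    refine mul_le_mul_of_nonneg_left ?_ zero_le
    rw [Finset.mul_sum, Finset.mul_sum]
    refine Finset.sum_le_sum fun b _ => ?_
    rw [← hcst]
    exact lintegral_mono fun x => hK B Q (g b) hQ (hband b) _ _

theorem exists_iSup_bound {c : ℝ} (hc : 0 < c) (hc' : c < 1 / 2) :
    ∃ K : ℝ≥0, ∀ (B : Type*) [NormedAddCommGroup B] [NormedSpace ℂ B] [CompleteSpace B]
      (Q : ℕ) [NeZero Q] (F : AZ → B) (g : ZMod Q → 𝓢(ℝ, B)),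
      (∀ x y, F (x, y) = g (modHom Q y) x) → (∀ b ξ, c / Q < |ξ| → 𝓕 (g b) ξ = 0) →
      ∀ z, ‖F z‖ₑ ≤ K * ⨆ n : ℤ, ‖sampling F n‖ₑ := by
  obtain ⟨K, hK⟩ := exists_enorm_le_iSup hc hc'
  refine ⟨K, fun B _ _ _ Q _ F g hg hband z => ?_⟩
  have hQ : (0 : ℝ) < Q := by exact_mod_cast NeZero.pos Q
  set b := modHom Q z.2
  have h : F z = g b z.1 := hg z.1 z.2
  rw [h]
  refine (hK B Q (g b) hQ (hband b) b.val z.1).trans ?_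
  refine mul_le_mul_of_nonneg_left (iSup_le fun m => ?_) zero_le
  rw [← sampling_eq hg]
  exact le_iSup (fun n : ℤ => ‖sampling F n‖ₑ) _

end Adelic

theorem mainTheorem9 (p : ℝ≥0∞) (hp : 0 < p) (c₀ : ℝ) (hc₀ : 0 < c₀) (hc₀' : c₀ < 1 / 2) :
    ∃ C : ℝ≥0, 0 < C ∧
      ∀ (B : Type*) [NormedAddCommGroup B] [NormedSpace ℂ B] [FiniteDimensional ℂ B]
        (Q : ℕ), 0 < Q → ∀ F : Adelic.AZ → B, Adelic.IsSchwartzBruhat F →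
        Adelic.FourierSupportedIn F
          (Set.Icc (-(c₀ / Q)) (c₀ / Q) ×ˢ Adelic.fracSubgroup Q) →
        eLpNorm (Adelic.sampling F) p Measure.count ≤ C * eLpNorm F p Adelic.haarAZ ∧
        eLpNorm F p Adelic.haarAZ ≤ C * eLpNorm (Adelic.sampling F) p Measure.count := by
  rcases eq_or_ne p ∞ with rfl | hp_top
  · obtain ⟨K, hK⟩ := Adelic.exists_iSup_bound hc₀ hc₀'
    refine ⟨max K 1, by positivity, fun B _ _ _ Q hQ F hF hsupp => ?_⟩
    have : NeZero Q := ⟨hQ.ne'⟩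
    have : CompleteSpace B := FiniteDimensional.complete ℂ B
    obtain ⟨g, hg, hband⟩ := Adelic.exists_eq_modHom_of_fourierSupportedIn hF hsupp
    have hsup : ∀ n, ‖Adelic.sampling F n‖ₑ ≤
        eLpNormEssSup (Adelic.sampling F) Measure.count := fun n =>
      Measure.ae_count_iff.mp (enorm_ae_le_eLpNormEssSup (Adelic.sampling F) Measure.count) n
    rw [eLpNorm_exponent_top, eLpNorm_exponent_top]
    constructor
    · calc eLpNormEssSup (Adelic.sampling F) Measure.count
          ≤ eLpNormEssSup F Adelic.haarAZ :=
            eLpNormEssSup_le_of_ae_enorm_bound (Filter.Eventually.of_forall fun n =>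
              Adelic.enorm_le_eLpNormEssSup_haarAZ hg _)
        _ = 1 * eLpNormEssSup F Adelic.haarAZ := (one_mul _).symm
        _ ≤ _ := by
          gcongr
          exact_mod_cast le_max_right K 1
    · refine eLpNormEssSup_le_of_ae_enorm_bound (Filter.Eventually.of_forall fun z => ?_)
      refine (hK B Q F g hg hband z).trans ?_
      gcongr
      · exact le_max_left K 1
      · exact iSup_le hsup
  · have hp' : 0 < p.toReal := ENNReal.toReal_pos hp.ne' hp_top
    obtain ⟨K, hK⟩ := Adelic.exists_rpow_bounds hp' hc₀ hc₀'
    refine ⟨max K 1 ^ (1 / p.toReal), by positivity, fun B _ _ _ Q hQ F hF hsupp => ?_⟩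
    have : NeZero Q := ⟨hQ.ne'⟩
    have : CompleteSpace B := FiniteDimensional.complete ℂ B
    obtain ⟨g, hg, hband⟩ := Adelic.exists_eq_modHom_of_fourierSupportedIn hF hsupp
    obtain ⟨h1, h2⟩ := hK B Q F g hg hband
    have hroot : ∀ {u v : ℝ≥0∞}, u ≤ K * v →
        u ^ (1 / p.toReal) ≤ ((max K 1 ^ (1 / p.toReal) : ℝ≥0) : ℝ≥0∞) * v ^ (1 / p.toReal) := by
      intro u v huv
      rw [ENNReal.coe_rpow_of_nonneg _ (by positivity),
        ← ENNReal.mul_rpow_of_nonneg _ _ (by positivity)]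
      gcongr
      refine huv.trans ?_
      gcongr
      exact le_max_left K 1
    rw [eLpNorm_eq_lintegral_rpow_enorm_toReal hp.ne' hp_top,
      eLpNorm_eq_lintegral_rpow_enorm_toReal hp.ne' hp_top, lintegral_count]
    exact ⟨hroot h1, hroot h2⟩
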